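/- Theorem (positive correlation via Harris–FKG). Let $W\subset\mathbb R^d$ be a convex set of volume $1$, let $t>0$ and $\delta>0$, and let $L\subset\mathbb R^d$ be a fixed two-dimensional linear plane (so $d\ge 2$), with orthogonal projection $x\mapsto x|_L$. Let $V=\{X_1,\dots,X_n\}$ be a Poisson point process of intensity $t$ in $W$: $n$ is Poisson distributed with mean $t$, and $X_1,X_2,\dots$ are independent, uniformly distributed in $W$ and independent of $n$. Let $G$ be the geometric graph with vertex set $V$ in which two distinct points are adjacent iff their distance is at most $\delta$, and let $G_L$ be its projection to $L$. For a finite set $V\subset\mathbb R^d$ let $V^k_{\neq}$ be the set of ordered $k$-tuples of pairwise distinct points of $V$, let $[u,v]$ be the segment between $u$ and $v$ if $\|u-v\|\le\delta$ and $[u,v]=\emptyset$ otherwise, and put $$\overline{\rm cr}(G_L)=\frac18\sum_{(v_1,v_2,v_3,v_4)\in V^4_{\neq}}\mathbf 1\bigl([v_1,v_2]|_L\cap[v_3,v_4]|_L\neq\emptyset\bigr),$$ $${\rm stress}(G,G_L)=\frac12\sum_{(v_1,v_2)\in V^2_{\neq}}w(v_1,v_2)\bigl(d_0(v_1,v_2)-\|v_1|_L-v_2|_L\|\bigr)^2,$$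 where $w$ is a measurable weight function that is positive on pairs of distinct points, and $d_0$ is a measurable real-valued function of two points (for example $d_0(v_1,v_2)=\|v_1-v_2\|$). Then: (i) As functionals $F$ of the finite vertex set, $\overline{\rm cr}(G_L)$ and ${\rm stress}(G,G_L)$ are increasing: $F(V\cup\{v\})-F(V)\ge 0$ for every finite $V\subset\mathbb R^d$ and every $v\in\mathbb R^d$. (ii) With expectations in $[0,\infty]$ (and $0\cdot\infty=0$), $$\mathbb E\bigl[\overline{\rm cr}(G_L)\,{\rm stress}(G,G_L)\bigr]\ \ge\ \mathbb E\bigl[\overline{\rm cr}(G_L)\bigr]\;\mathbb E\bigl[{\rm stress}(G,G_L)\bigr].$$ (iii) If $\mathbb E[{\rm stress}(G,G_L)]<\infty$, then all three expectations in (ii) are finite, the inequality holds between real numbers, and the covariance of $\overline{\rm cr}(G_L)$ and ${\rm stress}(G,G_L)$ is nonnegative. -/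

import Mathlib

open MeasureTheory ProbabilityTheory
open scoped NNReal ENNReal

noncomputable section

namespace RGG

/-- `ℝ^d` with its Euclidean norm. -/
abbrev Space (d : ℕ) : Type := EuclideanSpace ℝ (Fin d)

open Classical in
/-- The set `V^k_≠` of ordered `k`-tuples of pairwise distinct elements of a finite set `V`. -/
def distinctTuples {d : ℕ} (k : ℕ) (V : Finset (Space d)) : Finset (Fin k → Space d) :=
  (Fintype.piFinset fun _ : Fin k => V).filter Function.Injective

/-- The sum `U(k, f)` of `f` over all ordered `k`-tuples of pairwise distinct points of `V`. -/
def uStatistic {d : ℕ} (k : ℕ) (f : (Fin k → Space d) → ℝ) (V : Finset (Space d)) : ℝ :=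
  ∑ v ∈ distinctTuples k V, f v

/-- The drawing of the potential edge between `u` and `v` in the geometric graph with threshold
distance `δ`: the segment from `u` to `v` if their distance is at most `δ`, otherwise empty. -/
def edgeSegment {d : ℕ} (δ : ℝ) (u v : Space d) : Set (Space d) :=
  {x | dist u v ≤ δ ∧ x ∈ segment ℝ u v}

open Classical in
/-- The rectilinear crossing number of the drawing `G_L`, where `G` is the geometric graph with
vertex set `V` and threshold distance `δ`, projected orthogonally onto `L`. Each pair of crossing
edges is represented by eight ordered quadruples. -/
def crossingNumber {d : ℕ} (δ : ℝ) (L : Submodule ℝ (Space d)) (V : Finset (Space d)) : ℝ :=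
  (1 / 8 : ℝ) * uStatistic 4 (fun v =>
    if ((L.starProjection '' edgeSegment δ (v 0) (v 1)) ∩
        (L.starProjection '' edgeSegment δ (v 2) (v 3))).Nonempty then 1 else 0) V

/-- The stress of the projection onto `L` of the geometric graph with vertex set `V`, for the
weight function `w` and the prescribed distances `d₀`. -/
def stress {d : ℕ} (w d₀ : Space d → Space d → ℝ) (L : Submodule ℝ (Space d))
    (V : Finset (Space d)) : ℝ :=
  (1 / 2 : ℝ) * uStatistic 2 (fun v =>
    w (v 0) (v 1) *
      (d₀ (v 0) (v 1) - dist (L.starProjection (v 0)) (L.starProjection (v 1))) ^ 2) V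

open Classical in
/-- The difference (add-one-cost) operator `D_v F (V) = F (V ∪ {v}) - F (V)`. -/
def addOneCost {d : ℕ} (v : Space d) (F : Finset (Space d) → ℝ) (V : Finset (Space d)) : ℝ :=
  F (insert v V) - F V

/-- A functional `F` of finite point sets is increasing if `D_v F (V) ≥ 0` for all `v` and `V`. -/
def IsIncreasing {d : ℕ} (F : Finset (Space d) → ℝ) : Prop :=
  ∀ (V : Finset (Space d)) (v : Space d), 0 ≤ addOneCost v F V

/-- The data of a Poisson point process of intensity `t` in a set `W` of volume one: a Poisson
random number `N` with mean `t` and, independently of it, independent points `X 0, X 1, …`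
that are uniformly distributed in `W`. -/
structure IsPoissonSample {d : ℕ} {Ω : Type*} [MeasurableSpace Ω] (P : Measure Ω)
    (W : Set (Space d)) (t : ℝ≥0) (N : Ω → ℕ) (X : ℕ → Ω → Space d) : Prop where
  measurable_count : Measurable N
  measurable_point : ∀ i, Measurable (X i)
  law_count : P.map N = poissonMeasure t
  law_point : ∀ i, P.map (X i) = cond volume W
  indep_points : iIndepFun X P
  indep_count_points : IndepFun N (fun ω i => X i ω) P

open Classical in
/-- The point process `V = {X 0, …, X (N - 1)}`. -/
def pointProcess {d : ℕ} {Ω : Type*} (N : Ω → ℕ) (X : ℕ → Ω → Space d) (ω : Ω) :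
    Finset (Space d) :=
  (Finset.range (N ω)).image fun i => X i ω

end RGG

end

/-!
The crossing number and the stress are, up to positive constants, U-statistics of the vertex set:
sums of a kernel over all ordered tuples of distinct points, where the kernels `f` (of four points)
and `g` (of two points) are nonnegative on tuples of distinct points. Adding a point only adds
summands, so both functionals are increasing (`RGG.isIncreasing_uStatistic`).

For U-statistics, the Harris–FKG inequality follows from the multivariate Mecke formula
`E ∑ F = t ^ k * ∫ F dν ^ k` (`RGG.IsPoissonSample.lintegral_tupleSum`), in which the sum ranges
over `k`-tuples of distinct points and `ν` is the uniform distribution on `W`. The product of the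
two sums is a sum over pairs of tuples. All its summands are nonnegative, and those in which the two
tuples have no common point form the U-statistic with kernel `f ⊗ g` on six points
(`RGG.tupleSum_add_le_mul`). By the Mecke formula and Fubini's theorem its mean is
`t ^ 6 * ∫ f * ∫ g`, which is the product of the two means
(`RGG.IsPoissonSample.lintegral_tupleSum_mul_le`).

The Mecke formula itself rests on two facts: given `N = n`, there are `n.descFactorial k` tuples of
distinct indices, each contributing `∫ F dν ^ k`, and the factorial moments of the Poisson
distribution are `t ^ k`. The points are almost surely distinct since the volume has no atoms, so
sums over distinct points may be replaced by sums over distinct indices.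

For the finiteness claims, the crossing number is at most `N ^ 4`, and by the weighted Mecke formula
`RGG.IsPoissonSample.lintegral_mul_tupleSum` the mean of `N ^ 4` times the stress is bounded by
`E[N ^ 6]` times the integral of `g`, which is finite when the stress has a finite mean.
-/

/-! ### Sums over tuples of distinct indices -/

namespace RGG

open Classical in
/-- The injective `k`-tuples of indices in `{0, …, n - 1}`. -/
def indexTuples (k n : ℕ) : Finset (Fin k → ℕ) :=
  (Fintype.piFinset fun _ : Fin k => Finset.range n).filter Function.Injective

lemma mem_indexTuples {k n : ℕ} {i : Fin k → ℕ} :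
    i ∈ indexTuples k n ↔ (∀ j, i j < n) ∧ Function.Injective i := by
  simp [indexTuples]

lemma card_indexTuples (k n : ℕ) : (indexTuples k n).card = n.descFactorial k := by
  have h : (indexTuples k n) = (Finset.univ : Finset (Fin k ↪ Fin n)).map
      ⟨fun e j => (e j : ℕ), fun e e' h => by
        ext j; exact congrFun h j⟩ := by
    ext i
    simp only [mem_indexTuples, Finset.mem_map, Finset.mem_univ, true_and]
    constructor
    · rintro ⟨h1, h2⟩
      exact ⟨⟨fun j => ⟨i j, h1 j⟩, fun a b hab => h2 (by simpa using hab)⟩, rfl⟩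
    · rintro ⟨e, rfl⟩
      exact ⟨fun j => (e j).2, fun a b hab => e.injective (Fin.ext hab)⟩
  rw [h, Finset.card_map, Finset.card_univ, Fintype.card_embedding_eq, Fintype.card_fin,
    Fintype.card_fin]

/-- The sum of `F` over all `k`-tuples of terms of the sequence `x` that carry pairwise distinct
indices below `n`, with values in `[0, ∞]`. -/
noncomputable def tupleSum {E : Type*} (k : ℕ) (F : (Fin k → E) → ℝ≥0∞) (n : ℕ) (x : ℕ → E) : ℝ≥0∞ :=
  ∑ i ∈ indexTuples k n, F fun j => x (i j)

lemma tupleSum_le_pow {E : Type*} {k : ℕ} {F : (Fin k → E) → ℝ≥0∞} (hF : ∀ v, F v ≤ 1)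
    (n : ℕ) (x : ℕ → E) : tupleSum k F n x ≤ (n : ℝ≥0∞) ^ k := by
  calc tupleSum k F n x ≤ ∑ _i ∈ indexTuples k n, (1 : ℝ≥0∞) :=
        Finset.sum_le_sum fun i _ => hF _
    _ = ((n.descFactorial k : ℕ) : ℝ≥0∞) := by simp [card_indexTuples]
    _ ≤ (n : ℝ≥0∞) ^ k := by exact_mod_cast Nat.descFactorial_le_pow n k

/-- Splitting a tuple of distinct indices into two parts yields two tuples of distinct indices, and
every pair of index tuples arises at most once; the missing pairs share an index. -/
lemma tupleSum_add_le_mul {E : Type*} {k m : ℕ} (F : (Fin k → E) → ℝ≥0∞)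
    (G : (Fin m → E) → ℝ≥0∞) (n : ℕ) (x : ℕ → E) :
    tupleSum (k + m) (fun v => F (fun j => v (Fin.castAdd m j)) * G fun j => v (Fin.natAdd k j)) n x
      ≤ tupleSum k F n x * tupleSum m G n x := by
  classical
  unfold tupleSum
  rw [Finset.sum_mul_sum, ← Finset.sum_product']
  let s : (Fin (k + m) → ℕ) → (Fin k → ℕ) × (Fin m → ℕ) :=
    fun i => (fun j => i (Fin.castAdd m j), fun j => i (Fin.natAdd k j))
  have hs : Function.Injective s := by
    intro a b hab
    have h1 := congrArg Prod.fst hab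
    have h2 := congrArg Prod.snd hab
    funext j
    refine Fin.addCases (fun j => congrFun h1 j) (fun j => congrFun h2 j) j
  rw [← Finset.sum_image (s := indexTuples (k + m) n) (g := s)
    (f := fun p => F (fun j => x (p.1 j)) * G fun j => x (p.2 j)) hs.injOn]
  refine Finset.sum_le_sum_of_subset fun p hp => ?_
  obtain ⟨i, hi, rfl⟩ := Finset.mem_image.1 hp
  rw [mem_indexTuples] at hi
  refine Finset.mem_product.2 ⟨mem_indexTuples.2 ⟨fun j => hi.1 _, ?_⟩,
    mem_indexTuples.2 ⟨fun j => hi.1 _, ?_⟩⟩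
  · exact hi.2.comp (Fin.castAdd_injective k m)
  · exact hi.2.comp (Fin.natAdd_injective m k)

/-! ### U-statistics of point sets -/

lemma mem_distinctTuples {d k : ℕ} {V : Finset (Space d)} {v : Fin k → Space d} :
    v ∈ distinctTuples k V ↔ (∀ j, v j ∈ V) ∧ Function.Injective v := by
  simp [distinctTuples]

lemma isIncreasing_uStatistic {d k : ℕ} {c : ℝ} (hc : 0 ≤ c) {f : (Fin k → Space d) → ℝ}
    (hf : ∀ v, Function.Injective v → 0 ≤ f v) : IsIncreasing fun V => c * uStatistic k f V := by
  classical
  intro V v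
  refine sub_nonneg.2 (mul_le_mul_of_nonneg_left ?_ hc)
  refine Finset.sum_le_sum_of_subset_of_nonneg (fun u hu => ?_) fun u hu _ =>
    hf u (mem_distinctTuples.1 hu).2
  rw [mem_distinctTuples] at hu ⊢
  exact ⟨fun j => Finset.mem_insert_of_mem (hu.1 j), hu.2⟩

lemma uStatistic_nonneg {d k : ℕ} {f : (Fin k → Space d) → ℝ}
    (hf : ∀ v, Function.Injective v → 0 ≤ f v) (V : Finset (Space d)) : 0 ≤ uStatistic k f V :=
  Finset.sum_nonneg fun v hv => hf v (mem_distinctTuples.1 hv).2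

lemma uStatistic_image_range {d k n : ℕ} [DecidableEq (Space d)] (f : (Fin k → Space d) → ℝ)
    {x : ℕ → Space d} (hx : Function.Injective x) :
    uStatistic k f ((Finset.range n).image x) = ∑ i ∈ indexTuples k n, f fun j => x (i j) := by
  classical
  have h : distinctTuples k ((Finset.range n).image x)
      = (indexTuples k n).image fun i j => x (i j) := by
    ext v
    simp only [mem_distinctTuples, Finset.mem_image, Finset.mem_range, mem_indexTuples]
    constructor
    · rintro ⟨h1, h2⟩
      choose i hi hix using h1
      refine ⟨i, ⟨hi, fun a b hab => h2 ?_⟩, funext hix⟩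
      rw [← hix a, ← hix b, hab]
    · rintro ⟨i, ⟨h1, h2⟩, rfl⟩
      exact ⟨fun j => ⟨i j, h1 j, rfl⟩, hx.comp h2⟩
  rw [uStatistic, h, Finset.sum_image]
  intro a _ b _ hab
  funext j
  exact hx (congrFun hab j)

lemma ofReal_uStatistic_image_range {d k n : ℕ} [DecidableEq (Space d)] {c : ℝ} (hc : 0 ≤ c)
    {f : (Fin k → Space d) → ℝ} (hf : ∀ v, Function.Injective v → 0 ≤ f v)
    {x : ℕ → Space d} (hx : Function.Injective x) :
    ENNReal.ofReal (c * uStatistic k f ((Finset.range n).image x))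
      = ENNReal.ofReal c * tupleSum k (fun v => ENNReal.ofReal (f v)) n x := by
  rw [uStatistic_image_range f hx, ENNReal.ofReal_mul hc, ENNReal.ofReal_sum_of_nonneg, tupleSum]
  intro i hi
  exact hf _ (hx.comp (mem_indexTuples.1 hi).2)

/-! ### Factorial moments of the Poisson distribution -/

lemma lintegral_poissonMeasure (t : ℝ≥0) (φ : ℕ → ℝ≥0∞) :
    ∫⁻ n, φ n ∂(poissonMeasure t)
      = ∑' n, φ n * ENNReal.ofReal (Real.exp (-t) * t ^ n / n.factorial) := by
  rw [lintegral_countable']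
  simp_rw [poissonMeasure_singleton]

/-- The `k`-th factorial moment of the Poisson distribution with mean `t` is `t ^ k`: the terms
with `n < k` vanish, and the others are `t ^ k` times the Poisson weights, shifted by `k`. -/
lemma lintegral_descFactorial_poissonMeasure (t : ℝ≥0) (k : ℕ) :
    ∫⁻ n, (n.descFactorial k : ℝ≥0∞) ∂(poissonMeasure t) = (t : ℝ≥0∞) ^ k := by
  rw [lintegral_poissonMeasure, ← ENNReal.summable.sum_add_tsum_nat_add' (k := k),
    Finset.sum_eq_zero, zero_add]
  · have h : ∀ n : ℕ, ((n + k).descFactorial k : ℝ≥0∞) *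
        ENNReal.ofReal (Real.exp (-t) * t ^ (n + k) / (n + k).factorial)
        = (t : ℝ≥0∞) ^ k * poissonMeasure t {n} := by
      intro n
      have h1 : (n + k).factorial = n.factorial * (n + k).descFactorial k := by
        have := Nat.factorial_mul_descFactorial (Nat.le_add_left k n)
        rwa [Nat.add_sub_cancel, eq_comm] at this
      have h2 : ((n + k).descFactorial k : ℝ) ≠ 0 := by
        rw [Nat.cast_ne_zero, Ne, Nat.descFactorial_eq_zero_iff_lt]
        lia
      rw [poissonMeasure_singleton, ← ENNReal.ofReal_natCast, ← ENNReal.ofReal_coe_nnreal,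
        ← ENNReal.ofReal_pow t.coe_nonneg, ← ENNReal.ofReal_mul (by positivity),
        ← ENNReal.ofReal_mul (by positivity), h1]
      congr 1
      have h3 : (n.factorial : ℝ) ≠ 0 := by positivity
      push_cast
      field_simp
      ring
    simp_rw [h]
    rw [ENNReal.tsum_mul_left]
    have := lintegral_poissonMeasure t fun _ => 1
    simp only [lintegral_const, measure_univ, one_mul, ← poissonMeasure_singleton] at this
    rw [← this, mul_one]
  · intro n hn
    rw [Nat.descFactorial_of_lt (Finset.mem_range.1 hn), Nat.cast_zero, zero_mul]

lemma pow_le_add_descFactorial (n k : ℕ) :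
    n ^ k ≤ (2 * k) ^ k + 2 ^ k * n.descFactorial k := by
  rcases le_total n (2 * k) with h | h
  · exact (Nat.pow_le_pow_left h k).trans (Nat.le_add_right _ _)
  · calc n ^ k ≤ (2 * (n + 1 - k)) ^ k := Nat.pow_le_pow_left (by lia) k
      _ = 2 ^ k * (n + 1 - k) ^ k := mul_pow _ _ _
      _ ≤ 2 ^ k * n.descFactorial k := Nat.mul_le_mul_left _ (Nat.pow_sub_le_descFactorial n k)
      _ ≤ _ := Nat.le_add_left _ _

lemma lintegral_pow_poissonMeasure_lt_top (t : ℝ≥0) (k : ℕ) :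
    ∫⁻ n, (n : ℝ≥0∞) ^ k ∂(poissonMeasure t) < ∞ := by
  calc ∫⁻ n, (n : ℝ≥0∞) ^ k ∂(poissonMeasure t)
      ≤ ∫⁻ n, (((2 * k) ^ k : ℕ) + ((2 ^ k : ℕ) : ℝ≥0∞) * (n.descFactorial k : ℝ≥0∞))
          ∂(poissonMeasure t) :=
        lintegral_mono fun n => by
          dsimp only
          exact_mod_cast pow_le_add_descFactorial n k
    _ = ((2 * k) ^ k : ℕ) + ((2 ^ k : ℕ) : ℝ≥0∞) * (t : ℝ≥0∞) ^ k := by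
        rw [lintegral_add_left measurable_const, lintegral_const_mul _ (measurable_of_countable _),
          lintegral_descFactorial_poissonMeasure]
        simp
    _ < ∞ := by
        refine ENNReal.add_lt_top.2 ⟨ENNReal.natCast_lt_top _, ENNReal.mul_lt_top
          (ENNReal.natCast_lt_top _) (ENNReal.pow_lt_top ENNReal.coe_lt_top)⟩

/-! ### Expectations of sums over tuples -/

lemma lintegral_pi_mul {E : Type*} [MeasurableSpace E] (ν : Measure E) [IsProbabilityMeasure ν]
    {k m : ℕ} {F : (Fin k → E) → ℝ≥0∞} {G : (Fin m → E) → ℝ≥0∞}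
    (hF : Measurable F) (hG : Measurable G) :
    ∫⁻ v, F (fun j => v (Fin.castAdd m j)) * G (fun j => v (Fin.natAdd k j))
        ∂(Measure.pi fun _ : Fin (k + m) => ν)
      = (∫⁻ v, F v ∂(Measure.pi fun _ => ν)) * ∫⁻ v, G v ∂(Measure.pi fun _ => ν) := by
  have h1 := measurePreserving_piCongrLeft (fun _ : Fin (k + m) => ν) finSumFinEquiv
  have h2 := measurePreserving_sumPiEquivProdPi_symm (fun _ : Fin k ⊕ Fin m => ν)
  have h := h1.comp h2
  rw [← h.lintegral_comp (by fun_prop), ← lintegral_prod_mul hF.aemeasurable hG.aemeasurable]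
  refine lintegral_congr fun p => ?_
  congr 2
  · funext j
    have := Equiv.piCongrLeft_apply_apply (fun _ : Fin (k + m) => E) finSumFinEquiv
      ((MeasurableEquiv.sumPiEquivProdPi fun _ : Fin k ⊕ Fin m => E).symm p) (Sum.inl j)
    rw [finSumFinEquiv_apply_left] at this
    exact this
  · funext j
    have := Equiv.piCongrLeft_apply_apply (fun _ : Fin (k + m) => E) finSumFinEquiv
      ((MeasurableEquiv.sumPiEquivProdPi fun _ : Fin k ⊕ Fin m => E).symm p) (Sum.inr j)
    rw [finSumFinEquiv_apply_right] at this
    exact this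

lemma measurable_sum_indexTuples {E R : Type*} [MeasurableSpace E] [AddCommMonoid R]
    [MeasurableSpace R] [MeasurableAdd₂ R] {k : ℕ} {f : (Fin k → E) → R} (hf : Measurable f) :
    Measurable fun p : ℕ × (ℕ → E) => ∑ i ∈ indexTuples k p.1, f fun j => p.2 (i j) := by
  refine measurable_from_prod_countable_right fun n => ?_
  exact Finset.measurable_fun_sum (indexTuples k n)
    (f := fun i (x : ℕ → E) => f fun j => x (i j)) fun i _ => by fun_prop

namespace IsPoissonSample

variable {d : ℕ} {Ω : Type*} [MeasurableSpace Ω] {P : Measure Ω} {W : Set (Space d)} {t : ℝ≥0}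
  {N : Ω → ℕ} {X : ℕ → Ω → Space d}

lemma measurable_points (h : IsPoissonSample P W t N X) : Measurable fun ω i => X i ω :=
  measurable_pi_lambda _ h.measurable_point

lemma map_tuple [IsProbabilityMeasure P] (h : IsPoissonSample P W t N X) {k : ℕ} {i : Fin k → ℕ}
    (hi : Function.Injective i) :
    P.map (fun ω j => X (i j) ω) = Measure.pi fun _ => cond volume W := by
  have h1 := (iIndepFun_iff_map_fun_eq_pi_map
    (fun j => (h.measurable_point (i j)).aemeasurable)).1 (h.indep_points.precomp hi)
  simp only [h.law_point] at h1
  exact h1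

/-- A weighted form of the multivariate Mecke formula. By independence, given `N = n` each of the
`n.descFactorial k` summands has the mean of `F` with respect to the product measure. -/
lemma lintegral_mul_tupleSum [IsProbabilityMeasure P] (h : IsPoissonSample P W t N X) {k : ℕ}
    {F : (Fin k → Space d) → ℝ≥0∞} (hF : Measurable F) (φ : ℕ → ℝ≥0∞) :
    ∫⁻ ω, φ (N ω) * tupleSum k F (N ω) (fun i => X i ω) ∂P
      = (∫⁻ n, φ n * (n.descFactorial k : ℝ≥0∞) ∂(poissonMeasure t)) *
        ∫⁻ v, F v ∂(Measure.pi fun _ => cond volume W) := by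
  have hT : Measurable fun p : ℕ × (ℕ → Space d) => φ p.1 * tupleSum k F p.1 p.2 :=
    ((measurable_of_countable φ).comp measurable_fst).mul (measurable_sum_indexTuples hF)
  have hlaw := (indepFun_iff_map_prod_eq_prod_map_map h.measurable_count.aemeasurable
    h.measurable_points.aemeasurable).1 h.indep_count_points
  have : IsProbabilityMeasure (P.map fun ω i => X i ω) :=
    Measure.isProbabilityMeasure_map h.measurable_points.aemeasurable
  rw [← lintegral_map (f := fun p : ℕ × (ℕ → Space d) => φ p.1 * tupleSum k F p.1 p.2) hT
    (h.measurable_count.prodMk h.measurable_points), hlaw, lintegral_prod _ hT.aemeasurable,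
    h.law_count, ← lintegral_mul_const _ (measurable_of_countable _)]
  refine lintegral_congr fun n => ?_
  have hterm : ∀ i ∈ indexTuples k n,
      ∫⁻ x, F (fun j => x (i j)) ∂(P.map fun ω i => X i ω)
        = ∫⁻ v, F v ∂(Measure.pi fun _ => cond volume W) := by
    intro i hi
    rw [← h.map_tuple (mem_indexTuples.1 hi).2,
      lintegral_map (by fun_prop) h.measurable_points,
      lintegral_map hF (measurable_pi_lambda _ fun j => h.measurable_point _)]
  simp only [tupleSum]
  rw [lintegral_const_mul _ (Finset.measurable_fun_sum _ fun i _ => by fun_prop),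
    lintegral_finsetSum _ fun i _ => by fun_prop, Finset.sum_congr rfl hterm,
    Finset.sum_const, card_indexTuples, nsmul_eq_mul, mul_assoc]

/-- The multivariate Mecke formula for a Poisson point process. -/
lemma lintegral_tupleSum [IsProbabilityMeasure P] (h : IsPoissonSample P W t N X) {k : ℕ}
    {F : (Fin k → Space d) → ℝ≥0∞} (hF : Measurable F) :
    ∫⁻ ω, tupleSum k F (N ω) (fun i => X i ω) ∂P
      = (t : ℝ≥0∞) ^ k * ∫⁻ v, F v ∂(Measure.pi fun _ => cond volume W) := by
  have h1 := h.lintegral_mul_tupleSum hF fun _ => 1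
  simpa only [one_mul, lintegral_descFactorial_poissonMeasure] using h1

/-- Nonnegative U-statistics of a Poisson point process are positively correlated: the summands of
the product with disjoint index tuples alone have the product of the means as expectation. -/
lemma lintegral_tupleSum_mul_le [IsProbabilityMeasure P] (h : IsPoissonSample P W t N X)
    (hW : volume W = 1) {k m : ℕ}
    {F : (Fin k → Space d) → ℝ≥0∞} {G : (Fin m → Space d) → ℝ≥0∞}
    (hF : Measurable F) (hG : Measurable G) :
    (∫⁻ ω, tupleSum k F (N ω) (fun i => X i ω) ∂P) *
        (∫⁻ ω, tupleSum m G (N ω) (fun i => X i ω) ∂P)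
      ≤ ∫⁻ ω, tupleSum k F (N ω) (fun i => X i ω) * tupleSum m G (N ω) (fun i => X i ω) ∂P := by
  have : IsProbabilityMeasure (cond volume W) :=
    cond_isProbabilityMeasure_of_finite (by simp [hW]) (by simp [hW])
  refine le_trans (le_of_eq ?_)
    (lintegral_mono fun ω => tupleSum_add_le_mul F G (N ω) fun i => X i ω)
  rw [h.lintegral_tupleSum hF, h.lintegral_tupleSum hG,
    h.lintegral_tupleSum (by fun_prop), lintegral_pi_mul _ hF hG, pow_add]
  ring

/-- The volume has no atoms in dimension at least one, so the points are almost surely distinct. -/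
lemma ae_injective [IsProbabilityMeasure P] (h : IsPoissonSample P W t N X)
    [Nontrivial (Space d)] : ∀ᵐ ω ∂P, Function.Injective fun i => X i ω := by
  have hne : ∀ i j, i ≠ j → ∀ᵐ ω ∂P, X i ω ≠ X j ω := by
    intro i j hij
    have hlaw := (indepFun_iff_map_prod_eq_prod_map_map (h.measurable_point i).aemeasurable
      (h.measurable_point j).aemeasurable).1 (h.indep_points.indepFun hij)
    have : IsProbabilityMeasure (P.map (X j)) :=
      Measure.isProbabilityMeasure_map (h.measurable_point j).aemeasurable
    have hD : MeasurableSet {p : Space d × Space d | p.1 = p.2} := measurableSet_diagonal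
    have h0 : (P.map fun ω => (X i ω, X j ω)) {p | p.1 = p.2} = 0 := by
      rw [hlaw, Measure.measure_prod_null hD]
      refine Filter.Eventually.of_forall fun x => ?_
      have hx : Prod.mk x ⁻¹' {p : Space d × Space d | p.1 = p.2} = {x} := by
        ext y; simp [eq_comm]
      change P.map (X j) (Prod.mk x ⁻¹' {p | p.1 = p.2}) = 0
      rw [hx, h.law_point]
      exact (cond_absolutelyContinuous (μ := volume) (s := W)) (measure_singleton x)
    rw [Measure.map_apply ((h.measurable_point i).prodMk (h.measurable_point j)) hD] at h0
    exact measure_eq_zero_iff_ae_notMem.1 h0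
  have hall : ∀ᵐ ω ∂P, ∀ i j, i ≠ j → X i ω ≠ X j ω := by
    simp only [ae_all_iff]
    exact hne
  filter_upwards [hall] with ω hω i j hij
  by_contra hne
  exact hω i j hne hij

/-! ### U-statistics of the Poisson point process -/

lemma measurable_tupleSum (h : IsPoissonSample P W t N X) {k : ℕ}
    {F : (Fin k → Space d) → ℝ≥0∞} (hF : Measurable F) :
    Measurable fun ω => tupleSum k F (N ω) fun i => X i ω := by
  have hT : Measurable fun p : ℕ × (ℕ → Space d) => tupleSum k F p.1 p.2 :=
    measurable_sum_indexTuples hF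
  simpa only [Function.comp_def] using
    hT.comp (h.measurable_count.prodMk h.measurable_points)

lemma ae_ofReal_uStatistic [IsProbabilityMeasure P] (h : IsPoissonSample P W t N X)
    [Nontrivial (Space d)] {k : ℕ} {c : ℝ} (hc : 0 ≤ c) {f : (Fin k → Space d) → ℝ}
    (hf : ∀ v, Function.Injective v → 0 ≤ f v) :
    ∀ᵐ ω ∂P, ENNReal.ofReal (c * uStatistic k f (pointProcess N X ω))
      = ENNReal.ofReal c * tupleSum k (fun v => ENNReal.ofReal (f v)) (N ω) fun i => X i ω := by
  filter_upwards [h.ae_injective] with ω hω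
  exact ofReal_uStatistic_image_range hc hf hω

lemma aestronglyMeasurable_uStatistic [IsProbabilityMeasure P] (h : IsPoissonSample P W t N X)
    [Nontrivial (Space d)] {k : ℕ} (c : ℝ) {f : (Fin k → Space d) → ℝ} (hf : Measurable f) :
    AEStronglyMeasurable (fun ω => c * uStatistic k f (pointProcess N X ω)) P := by
  have hm : Measurable fun ω => c * ∑ i ∈ indexTuples k (N ω), f fun j => X (i j) ω :=
    ((measurable_sum_indexTuples hf).comp
      (h.measurable_count.prodMk h.measurable_points)).const_mul c
  refine hm.aestronglyMeasurable.congr ?_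
  filter_upwards [h.ae_injective] with ω hω
  rw [pointProcess, uStatistic_image_range f hω]

lemma ae_ofReal_uStatistic_mul [IsProbabilityMeasure P] (h : IsPoissonSample P W t N X)
    [Nontrivial (Space d)] {k m : ℕ} {a b : ℝ} (ha : 0 ≤ a) (hb : 0 ≤ b)
    {f : (Fin k → Space d) → ℝ} {g : (Fin m → Space d) → ℝ}
    (hf : ∀ v, Function.Injective v → 0 ≤ f v) (hg : ∀ v, Function.Injective v → 0 ≤ g v) :
    ∀ᵐ ω ∂P, ENNReal.ofReal (a * uStatistic k f (pointProcess N X ω) *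
        (b * uStatistic m g (pointProcess N X ω)))
      = ENNReal.ofReal a * ENNReal.ofReal b *
        (tupleSum k (fun v => ENNReal.ofReal (f v)) (N ω) (fun i => X i ω) *
          tupleSum m (fun v => ENNReal.ofReal (g v)) (N ω) fun i => X i ω) := by
  filter_upwards [h.ae_ofReal_uStatistic ha hf, h.ae_ofReal_uStatistic hb hg] with ω h1 h2
  rw [ENNReal.ofReal_mul (mul_nonneg ha (uStatistic_nonneg hf _)), h1, h2]
  ring

/-- The correlation inequality for U-statistics with nonnegative kernels, in `[0, ∞]`. -/
lemma lintegral_uStatistic_mul_le [IsProbabilityMeasure P] (h : IsPoissonSample P W t N X)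
    [Nontrivial (Space d)] (hW : volume W = 1) {k m : ℕ} {a b : ℝ} (ha : 0 ≤ a) (hb : 0 ≤ b)
    {f : (Fin k → Space d) → ℝ} {g : (Fin m → Space d) → ℝ}
    (hfm : Measurable f) (hgm : Measurable g)
    (hf : ∀ v, Function.Injective v → 0 ≤ f v) (hg : ∀ v, Function.Injective v → 0 ≤ g v) :
    (∫⁻ ω, ENNReal.ofReal (a * uStatistic k f (pointProcess N X ω)) ∂P) *
        (∫⁻ ω, ENNReal.ofReal (b * uStatistic m g (pointProcess N X ω)) ∂P)
      ≤ ∫⁻ ω, ENNReal.ofReal (a * uStatistic k f (pointProcess N X ω) *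
          (b * uStatistic m g (pointProcess N X ω))) ∂P := by
  have hSF := h.measurable_tupleSum hfm.ennreal_ofReal
  have hSG := h.measurable_tupleSum hgm.ennreal_ofReal
  rw [lintegral_congr_ae (h.ae_ofReal_uStatistic ha hf),
    lintegral_congr_ae (h.ae_ofReal_uStatistic hb hg),
    lintegral_congr_ae (h.ae_ofReal_uStatistic_mul ha hb hf hg),
    lintegral_const_mul _ hSF, lintegral_const_mul _ hSG, lintegral_const_mul _ (by exact hSF.mul hSG),
    mul_mul_mul_comm]
  gcongr
  exact h.lintegral_tupleSum_mul_le hW hfm.ennreal_ofReal hgm.ennreal_ofReal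

/-- A U-statistic with bounded kernel is at most a power of the number of points, which has finite
moments of all orders. -/
lemma integrable_uStatistic [IsProbabilityMeasure P] (h : IsPoissonSample P W t N X)
    [Nontrivial (Space d)] {k : ℕ} {a : ℝ} (ha : 0 ≤ a) {f : (Fin k → Space d) → ℝ}
    (hfm : Measurable f) (hf : ∀ v, Function.Injective v → 0 ≤ f v) (hf1 : ∀ v, f v ≤ 1) :
    Integrable (fun ω => a * uStatistic k f (pointProcess N X ω)) P := by
  refine ⟨h.aestronglyMeasurable_uStatistic a hfm, (hasFiniteIntegral_iff_ofReal
    (Filter.Eventually.of_forall fun ω => mul_nonneg ha (uStatistic_nonneg hf _))).2 ?_⟩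
  rw [lintegral_congr_ae (h.ae_ofReal_uStatistic ha hf),
    lintegral_const_mul _ (h.measurable_tupleSum hfm.ennreal_ofReal)]
  refine ENNReal.mul_lt_top ENNReal.ofReal_lt_top ((lintegral_mono fun ω =>
    tupleSum_le_pow (fun v => ENNReal.ofReal_le_one.2 (hf1 v)) _ _).trans_lt ?_)
  rw [← lintegral_map (f := fun n : ℕ => (n : ℝ≥0∞) ^ k) (measurable_of_countable _)
    h.measurable_count, h.law_count]
  exact lintegral_pow_poissonMeasure_lt_top t k

/-- As the intensity is positive, integrability of the second U-statistic forces that of its kernel,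
and then the product is controlled through the weighted Mecke formula. -/
lemma integrable_uStatistic_mul [IsProbabilityMeasure P] (h : IsPoissonSample P W t N X)
    [Nontrivial (Space d)] (ht : 0 < t) {k m : ℕ} {a b : ℝ} (ha : 0 ≤ a) (hb : 0 < b)
    {f : (Fin k → Space d) → ℝ} {g : (Fin m → Space d) → ℝ}
    (hfm : Measurable f) (hgm : Measurable g)
    (hf : ∀ v, Function.Injective v → 0 ≤ f v) (hg : ∀ v, Function.Injective v → 0 ≤ g v)
    (hf1 : ∀ v, f v ≤ 1)
    (hint : Integrable (fun ω => b * uStatistic m g (pointProcess N X ω)) P) :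
    Integrable (fun ω => a * uStatistic k f (pointProcess N X ω) *
      (b * uStatistic m g (pointProcess N X ω))) P := by
  have hSF := h.measurable_tupleSum hfm.ennreal_ofReal
  have hSG := h.measurable_tupleSum hgm.ennreal_ofReal
  have hcr0 : ∀ ω, 0 ≤ a * uStatistic k f (pointProcess N X ω) := fun ω =>
    mul_nonneg ha (uStatistic_nonneg hf _)
  have hst0 : ∀ ω, 0 ≤ b * uStatistic m g (pointProcess N X ω) := fun ω =>
    mul_nonneg hb.le (uStatistic_nonneg hg _)
  have hG_fin : ∫⁻ v, ENNReal.ofReal (g v) ∂(Measure.pi fun _ => cond volume W) < ∞ := by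
    have h1 := (hasFiniteIntegral_iff_ofReal (Filter.Eventually.of_forall hst0)).1 hint.2
    rw [lintegral_congr_ae (h.ae_ofReal_uStatistic hb.le hg), lintegral_const_mul _ hSG,
      h.lintegral_tupleSum hgm.ennreal_ofReal] at h1
    refine lt_top_iff_ne_top.2 fun htop => h1.ne ?_
    have ht' : (t : ℝ≥0∞) ^ m ≠ 0 := pow_ne_zero _ (ENNReal.coe_ne_zero.2 ht.ne')
    rw [htop, ENNReal.mul_top ht', ENNReal.mul_top (ENNReal.ofReal_pos.2 hb).ne']
  refine ⟨(h.aestronglyMeasurable_uStatistic a hfm).mul hint.1, (hasFiniteIntegral_iff_ofReal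
    (Filter.Eventually.of_forall fun ω => mul_nonneg (hcr0 ω) (hst0 ω))).2 ?_⟩
  rw [lintegral_congr_ae (h.ae_ofReal_uStatistic_mul ha hb.le hf hg),
    lintegral_const_mul _ (by exact hSF.mul hSG)]
  refine ENNReal.mul_lt_top (ENNReal.mul_lt_top ENNReal.ofReal_lt_top ENNReal.ofReal_lt_top)
    ((lintegral_mono fun ω => mul_le_mul_left
      (tupleSum_le_pow (fun v => ENNReal.ofReal_le_one.2 (hf1 v)) _ _) _).trans_lt ?_)
  rw [h.lintegral_mul_tupleSum hgm.ennreal_ofReal fun n => (n : ℝ≥0∞) ^ k]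
  refine ENNReal.mul_lt_top (lt_of_le_of_lt (lintegral_mono fun n => ?_)
    (lintegral_pow_poissonMeasure_lt_top t (k + m))) hG_fin
  dsimp only
  rw [pow_add]
  gcongr
  exact_mod_cast Nat.descFactorial_le_pow n m

end IsPoissonSample

/-! ### Covariance of integrable variables with integrable product -/

/-- No square integrability is needed here, in contrast to `covariance_eq_sub`. -/
lemma covariance_eq_sub_of_integrable {Ω : Type*} [MeasurableSpace Ω] {P : Measure Ω}
    [IsProbabilityMeasure P] {Y Z : Ω → ℝ} (hY : Integrable Y P) (hZ : Integrable Z P)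
    (hYZ : Integrable (fun ω => Y ω * Z ω) P) :
    covariance Y Z P = (∫ ω, Y ω * Z ω ∂P) - (∫ ω, Y ω ∂P) * ∫ ω, Z ω ∂P := by
  have hexp : ∀ ω, (Y ω - ∫ ω', Y ω' ∂P) * (Z ω - ∫ ω', Z ω' ∂P)
      = Y ω * Z ω - Y ω * (∫ ω', Z ω' ∂P)
        - (∫ ω', Y ω' ∂P) * (Z ω - ∫ ω', Z ω' ∂P) := fun ω => by ring
  have hY' : Integrable (fun ω => Y ω * ∫ ω', Z ω' ∂P) P := hY.mul_const _
  have hZ' : Integrable (fun ω => Z ω - ∫ ω', Z ω' ∂P) P := hZ.sub (integrable_const _)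
  rw [covariance, integral_congr_ae (Filter.Eventually.of_forall hexp),
    integral_sub (by exact hYZ.sub hY') (by exact hZ'.const_mul _), integral_sub hYZ hY',
    integral_mul_const, integral_const_mul, integral_sub hZ (integrable_const _)]
  simp

lemma integral_mul_le_of_lintegral_mul_le {Ω : Type*} [MeasurableSpace Ω] {P : Measure Ω}
    {Y Z : Ω → ℝ} (hY0 : ∀ ω, 0 ≤ Y ω) (hZ0 : ∀ ω, 0 ≤ Z ω) (hY : Integrable Y P)
    (hZ : Integrable Z P) (hYZ : Integrable (fun ω => Y ω * Z ω) P)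
    (hle : (∫⁻ ω, ENNReal.ofReal (Y ω) ∂P) * (∫⁻ ω, ENNReal.ofReal (Z ω) ∂P)
      ≤ ∫⁻ ω, ENNReal.ofReal (Y ω * Z ω) ∂P) :
    (∫ ω, Y ω ∂P) * (∫ ω, Z ω ∂P) ≤ ∫ ω, Y ω * Z ω ∂P := by
  have hYZ0 : ∀ ω, 0 ≤ Y ω * Z ω := fun ω => mul_nonneg (hY0 ω) (hZ0 ω)
  rw [← ofReal_integral_eq_lintegral_ofReal hY (Filter.Eventually.of_forall hY0),
    ← ofReal_integral_eq_lintegral_ofReal hZ (Filter.Eventually.of_forall hZ0),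
    ← ofReal_integral_eq_lintegral_ofReal hYZ (Filter.Eventually.of_forall hYZ0),
    ← ENNReal.ofReal_mul (integral_nonneg hY0)] at hle
  exact (ENNReal.ofReal_le_ofReal_iff (integral_nonneg hYZ0)).1 hle

/-! ### The kernels of the crossing number and of the stress -/

/-- The pairs of parameters of crossing points range over a compact set, so the set of crossing
quadruples is the projection of a closed set along a compact factor. -/
lemma isClosed_crossing {d : ℕ} (δ : ℝ) (L : Submodule ℝ (Space d)) :
    IsClosed {v : Fin 4 → Space d | ((L.starProjection '' edgeSegment δ (v 0) (v 1)) ∩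
        (L.starProjection '' edgeSegment δ (v 2) (v 3))).Nonempty} := by
  let A : Set ((unitInterval × unitInterval) × (Fin 4 → Space d)) :=
    {q | dist (q.2 0) (q.2 1) ≤ δ ∧ dist (q.2 2) (q.2 3) ≤ δ ∧
      L.starProjection (AffineMap.lineMap (q.2 0) (q.2 1) (q.1.1 : ℝ))
        = L.starProjection (AffineMap.lineMap (q.2 2) (q.2 3) (q.1.2 : ℝ))}
  have hA : IsClosed A := by
    simp only [A, AffineMap.lineMap_apply_module]
    refine IsClosed.and ?_ (IsClosed.and ?_ ?_)
    · exact isClosed_le (by fun_prop) (by fun_prop)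
    · exact isClosed_le (by fun_prop) (by fun_prop)
    · exact isClosed_eq (by fun_prop) (by fun_prop)
  convert isClosedMap_snd_of_compactSpace A hA using 1
  ext v
  simp only [Set.mem_ofPred_eq, Set.mem_image, A, edgeSegment, segment_eq_image_lineMap]
  constructor
  · rintro ⟨y, ⟨x, ⟨h1, ⟨a, ha, rfl⟩⟩, hx⟩, ⟨z, ⟨h2, ⟨b, hb, rfl⟩⟩, hz⟩⟩
    exact ⟨((⟨a, ha⟩, ⟨b, hb⟩), v), ⟨h1, h2, hx.trans hz.symm⟩, rfl⟩
  · rintro ⟨⟨⟨a, b⟩, u⟩, ⟨h1, h2, h3⟩, rfl⟩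
    exact ⟨_, ⟨_, ⟨h1, ⟨a, a.2, rfl⟩⟩, rfl⟩, ⟨_, ⟨h2, ⟨b, b.2, rfl⟩⟩, h3.symm⟩⟩

open Classical in
/-- The indicator that `v 0, v 1` and `v 2, v 3` are edges whose projections to `L` meet. -/
noncomputable def crossingKernel {d : ℕ} (δ : ℝ) (L : Submodule ℝ (Space d))
    (v : Fin 4 → Space d) : ℝ :=
  if ((L.starProjection '' edgeSegment δ (v 0) (v 1)) ∩
    (L.starProjection '' edgeSegment δ (v 2) (v 3))).Nonempty then 1 else 0

/-- The weighted squared distortion of the distance of two points under the projection to `L`. -/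
noncomputable def stressKernel {d : ℕ} (w d₀ : Space d → Space d → ℝ) (L : Submodule ℝ (Space d))
    (v : Fin 2 → Space d) : ℝ :=
  w (v 0) (v 1) * (d₀ (v 0) (v 1) - dist (L.starProjection (v 0)) (L.starProjection (v 1))) ^ 2

lemma crossingNumber_eq {d : ℕ} (δ : ℝ) (L : Submodule ℝ (Space d)) :
    crossingNumber δ L = fun V => (1 / 8 : ℝ) * uStatistic 4 (crossingKernel δ L) V := rfl

lemma stress_eq {d : ℕ} (w d₀ : Space d → Space d → ℝ) (L : Submodule ℝ (Space d)) :
    stress w d₀ L = fun V => (1 / 2 : ℝ) * uStatistic 2 (stressKernel w d₀ L) V := rfl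

lemma crossingKernel_nonneg {d : ℕ} (δ : ℝ) (L : Submodule ℝ (Space d)) (v : Fin 4 → Space d) :
    0 ≤ crossingKernel δ L v := by
  unfold crossingKernel
  split_ifs <;> norm_num

lemma crossingKernel_le_one {d : ℕ} (δ : ℝ) (L : Submodule ℝ (Space d)) (v : Fin 4 → Space d) :
    crossingKernel δ L v ≤ 1 := by
  unfold crossingKernel
  split_ifs <;> norm_num

lemma measurable_crossingKernel {d : ℕ} (δ : ℝ) (L : Submodule ℝ (Space d)) :
    Measurable (crossingKernel δ L) :=
  Measurable.ite (isClosed_crossing δ L).measurableSet measurable_const measurable_const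

lemma stressKernel_nonneg {d : ℕ} {w : Space d → Space d → ℝ} (hw : ∀ u v, u ≠ v → 0 < w u v)
    (d₀ : Space d → Space d → ℝ) (L : Submodule ℝ (Space d)) {v : Fin 2 → Space d}
    (hv : Function.Injective v) : 0 ≤ stressKernel w d₀ L v :=
  mul_nonneg (hw _ _ (hv.ne Fin.zero_ne_one)).le (sq_nonneg _)

lemma measurable_stressKernel {d : ℕ} {w d₀ : Space d → Space d → ℝ}
    (hw : Measurable (Function.uncurry w)) (hd₀ : Measurable (Function.uncurry d₀))
    (L : Submodule ℝ (Space d)) : Measurable (stressKernel w d₀ L) := by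
  have h01 : Measurable fun v : Fin 2 → Space d => (v 0, v 1) := by fun_prop
  have h1 : Measurable fun v : Fin 2 → Space d => w (v 0) (v 1) := hw.comp h01
  have h2 : Measurable fun v : Fin 2 → Space d => d₀ (v 0) (v 1) := hd₀.comp h01
  have h3 : Measurable fun v : Fin 2 → Space d =>
      dist (L.starProjection (v 0)) (L.starProjection (v 1)) :=
    Continuous.measurable (by fun_prop)
  exact h1.mul ((h2.sub h3).pow_const 2)

end RGG

theorem mainTheorem4 {d : ℕ} {Ω : Type*} [MeasurableSpace Ω] (P : Measure Ω)
    [IsProbabilityMeasure P]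
    (W : Set (RGG.Space d)) (hW : Convex ℝ W) (hWvol : volume W = 1)
    (t : ℝ≥0) (ht : 0 < t) (δ : ℝ) (hδ : 0 < δ)
    (N : Ω → ℕ) (X : ℕ → Ω → RGG.Space d) (hNX : RGG.IsPoissonSample P W t N X)
    (L : Submodule ℝ (RGG.Space d)) (hL : Module.finrank ℝ L = 2)
    (w d₀ : RGG.Space d → RGG.Space d → ℝ)
    (hw : Measurable (Function.uncurry w)) (hwpos : ∀ u v, u ≠ v → 0 < w u v)
    (hd₀ : Measurable (Function.uncurry d₀)) :
    let cr : Ω → ℝ := fun ω => RGG.crossingNumber δ L (RGG.pointProcess N X ω)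
    let st : Ω → ℝ := fun ω => RGG.stress w d₀ L (RGG.pointProcess N X ω)
    -- both functionals are increasing
    (RGG.IsIncreasing (RGG.crossingNumber δ L) ∧ RGG.IsIncreasing (RGG.stress w d₀ L)) ∧
    -- the correlation inequality for expectations with values in `[0, ∞]`
    (∫⁻ ω, ENNReal.ofReal (cr ω) ∂P) * (∫⁻ ω, ENNReal.ofReal (st ω) ∂P)
        ≤ ∫⁻ ω, ENNReal.ofReal (cr ω * st ω) ∂P ∧
    -- if the stress has a finite mean, then all means are finite and the covariance is nonnegative
    (Integrable st P →
      Integrable cr P ∧ Integrable (fun ω => cr ω * st ω) P ∧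
      (∫ ω, cr ω ∂P) * (∫ ω, st ω ∂P) ≤ ∫ ω, cr ω * st ω ∂P ∧
      0 ≤ covariance cr st P) := by
  intro cr st
  have hfm := RGG.measurable_crossingKernel δ L
  have hgm := RGG.measurable_stressKernel hw hd₀ L
  have hf0 : ∀ v, Function.Injective v → 0 ≤ RGG.crossingKernel δ L v :=
    fun v _ => RGG.crossingKernel_nonneg δ L v
  have hg0 : ∀ v, Function.Injective v → 0 ≤ RGG.stressKernel w d₀ L v :=
    fun v hv => RGG.stressKernel_nonneg hwpos d₀ L hv
  have h8 : (0 : ℝ) < 1 / 8 := by norm_num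
  have h2 : (0 : ℝ) < 1 / 2 := by norm_num
  have : Nontrivial (RGG.Space d) := by
    have : Nontrivial L := Module.nontrivial_of_finrank_pos (R := ℝ) (hL ▸ two_pos)
    exact (Subtype.val_injective (p := (· ∈ L))).nontrivial
  simp only [cr, st, RGG.crossingNumber_eq, RGG.stress_eq]
  have hle := hNX.lintegral_uStatistic_mul_le hWvol h8.le h2.le hfm hgm hf0 hg0
  refine ⟨⟨RGG.isIncreasing_uStatistic h8.le hf0, RGG.isIncreasing_uStatistic h2.le hg0⟩,
    hle, fun hst => ?_⟩
  have hcr := hNX.integrable_uStatistic h8.le hfm hf0 (RGG.crossingKernel_le_one δ L)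
  have hprod := hNX.integrable_uStatistic_mul ht h8.le h2 hfm hgm hf0 hg0
    (RGG.crossingKernel_le_one δ L) hst
  have hreal := RGG.integral_mul_le_of_lintegral_mul_le
    (fun ω => mul_nonneg h8.le (RGG.uStatistic_nonneg hf0 _))
    (fun ω => mul_nonneg h2.le (RGG.uStatistic_nonneg hg0 _)) hcr hst hprod hle
  refine ⟨hcr, hprod, hreal, ?_⟩
  rw [RGG.covariance_eq_sub_of_integrable hcr hst hprod]
  exact sub_nonneg.2 hreal
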